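/- **Setting.** Let $\mathcal D$ be a probability distribution on $\{0,1\}^n$, let $O$ be an $m$-qubit observable (a Hermitian $2^m\times 2^m$ matrix) with spectral norm $\|O\|\le 1$, let $\mathcal F$ be a family of completely positive trace-preserving (CPTP) maps from $n$ qubits to $m$ qubits, and let $\epsilon>0$. For $\mathcal E\in\mathcal F$ put $f_{\mathcal E}(x)=\mathrm{Tr}(O\,\mathcal E(|x\rangle\langle x|))$, and for $h,f:\{0,1\}^n\to\mathbb R$ put $d(h,f)=\sum_{x}\mathcal D(x)\,|h(x)-f(x)|^2$. A *quantum ML model with $N_Q$ queries* consists of a finite-dimensional initial state $\rho_0$, CPTP maps $\mathcal C_0,\dots,\mathcal C_{N_Q}$ between finite-dimensional systems, and a POVM $\{P_a\}$ with finitely many outcomes, each outcome $a$ labelled by a function $h_a:\{0,1\}^n\to\mathbb R$; run on $\mathcal E$ it outputs $h_Q=h_a$ with probability $\mathrm{Tr}(P_a\rho_{\mathcal E})$, where $\rho_{\mathcal E}=\mathcal C_{N_Q}(\mathcal E\otimes\mathcal I)\mathcal C_{N_Q-1}\cdots\mathcal C_1(\mathcal E\otimes\mathcal I)\mathcal C_0(\rho_0)$.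 A *restricted classical ML model with $N$ experiments* chooses inputs $x_1,\dots,x_N\in\{0,1\}^n$ by a randomized, possibly adaptive rule, receives for each $x_i$ the outcome $o_i\in\mathbb R$ of the projective measurement of $O$ on $\mathcal E(|x_i\rangle\langle x_i|)$, and outputs a (possibly randomized) function $h_C:\{0,1\}^n\to\mathbb R$ of the data. A *$4\epsilon$-packing net* is a finite set $S\subseteq\{f_{\mathcal E}:\mathcal E\in\mathcal F\}$ with $d(f,g)>4\epsilon$ for all distinct $f,g\in S$; it is *maximal* if no $4\epsilon$-packing net has more elements. **Theorem 1.** There is a universal constant $C>0$ (independent of $n,m,\mathcal D,O,\mathcal F,\epsilon$, of the models, and of $\delta$) such that the following holds. 1. Suppose a quantum ML model with $N_Q$ queries outputs, for every $\mathcal E\in\mathcal F$ and with probability at least $2/3$, a function $h_Q$ with $d(h_Q,f_{\mathcal E})\le\epsilon$. Then: - (a) for every $\delta\in(0,1)$ there is a restricted classical ML model with $N_C\le C\log(2/\delta)\, m N_Q/\epsilon$ experiments which, for every $\mathcal E\in\mathcal F$, outputs with probability at least $1-\delta$ a function $h_C$ with $d(h_C,f_{\mathcal E})\le 12\epsilon$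 (so $N_C=\mathcal O(mN_Q/\epsilon)$ and the error is $\mathcal O(\epsilon)$ for any fixed success probability); - (b) every $4\epsilon$-packing net $S$ satisfies $\log|S|\le C\,m\,N_Q$, that is, $N_Q=\Omega(\log|S|/m)$. 2. Let $S$ be a maximal $4\epsilon$-packing net, $\delta\in(0,1)$ and $N\ge C\log(4|S|/\delta)/\epsilon$. Then every restricted classical ML model that draws $x_1,\dots,x_N$ independently from $\mathcal D$ and outputs some minimizer $f_*$ of $\frac1N\sum_{i=1}^N|f(x_i)-o_i|^2$ over $f\in S$ satisfies, for every $\mathcal E\in\mathcal F$, $d(f_*,f_{\mathcal E})<12\epsilon$ with probability at least $1-\delta$. -/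

import Mathlib

open Matrix
open scoped ENNReal ComplexOrder

noncomputable section

namespace QML

/-- Bit strings of length `n`. They label the computational basis of `n` qubits. -/
abbrev Bits (n : ℕ) : Type := Fin n → Bool

/-- A quantum state (density matrix): positive semidefinite of trace one. -/
structure DensityMatrix (a : Type) [Fintype a] where
  mat : Matrix a a ℂ
  posSemidef : mat.PosSemidef
  trace_eq_one : mat.trace = 1

/-- `E ⊗ id` for a linear map `E` on matrices and an ancilla system with basis `k`. -/
def tensorId {a b : Type} (E : Matrix a a ℂ →ₗ[ℂ] Matrix b b ℂ) (k : Type) :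
    Matrix (a × k) (a × k) ℂ →ₗ[ℂ] Matrix (b × k) (b × k) ℂ where
  toFun M := Matrix.of fun p q => E (Matrix.of fun i j => M (i, p.2) (j, q.2)) p.1 q.1
  map_add' M N := by
    ext p q
    simp only [Matrix.of_apply, Matrix.add_apply]
    rw [← Matrix.add_apply, ← map_add]
    rfl
  map_smul' c M := by
    ext p q
    simp only [Matrix.of_apply, Matrix.smul_apply, RingHom.id_apply]
    rw [← Matrix.smul_apply, ← map_smul]
    rfl

/-- A completely positive trace-preserving map between two finite-dimensional systems. -/
structure Channel (a b : Type) [Fintype a] [Fintype b] where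
  toLin : Matrix a a ℂ →ₗ[ℂ] Matrix b b ℂ
  completelyPositive : ∀ (k : ℕ) (M : Matrix (a × Fin k) (a × Fin k) ℂ),
    M.PosSemidef → (tensorId toLin (Fin k) M).PosSemidef
  tracePreserving : ∀ M : Matrix a a ℂ, (toLin M).trace = M.trace

theorem Channel.map_posSemidef {a b : Type} [Fintype a] [Fintype b] (E : Channel a b)
    {M : Matrix a a ℂ} (hM : M.PosSemidef) : (E.toLin M).PosSemidef := by
  have h := (E.completelyPositive 1 (M.submatrix Prod.fst Prod.fst) (hM.submatrix _)).submatrix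
    (fun i : b => (i, (0 : Fin 1)))
  exact h

/-- The output state of a channel. -/
def Channel.apply {a b : Type} [Fintype a] [Fintype b] (E : Channel a b) (ρ : DensityMatrix a) :
    DensityMatrix b where
  mat := E.toLin ρ.mat
  posSemidef := E.map_posSemidef ρ.posSemidef
  trace_eq_one := by rw [E.tracePreserving, ρ.trace_eq_one]

/-- The computational basis state `|x⟩⟨x|`. -/
def basisState {a : Type} [Fintype a] [DecidableEq a] (x : a) : DensityMatrix a where
  mat := Matrix.single x x 1
  posSemidef := by
    have h : Matrix.single x x (1 : ℂ) = Matrix.diagonal (Pi.single x 1) := by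
      rw [Matrix.diagonal_single]
    rw [h]
    refine Matrix.PosSemidef.diagonal fun i => ?_
    by_cases hi : i = x
    · subst hi; simp
    · simp [hi]
  trace_eq_one := by simp

/-- The target function `f_E(x) = Tr(O E(|x⟩⟨x|))`. -/
def target {n m : ℕ} (O : Matrix (Bits m) (Bits m) ℂ) (E : Channel (Bits n) (Bits m))
    (x : Bits n) : ℝ :=
  (O * (E.apply (basisState x)).mat).trace.re

/-- The average squared deviation `∑ₓ D(x) |h(x) - f(x)|²`. -/
def avgErr {n : ℕ} (D : PMF (Bits n)) (h f : Bits n → ℝ) : ℝ :=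
  ∑ x, (D x).toReal * |h x - f x| ^ 2

/-! ### Quantum models -/

/-- A quantum learning model making `N` queries to an unknown channel from `n` to `m` qubits.
`init` is the initial state, `prep` the processing step before the first query and `proc t` the
processing step after query number `t + 1` (only those with `t < N` are used). The workspace next to
the `n` input qubits of the query has dimension `work t`. The whole prediction phase, for a fixed
order of the inputs, is one POVM on the quantum memory, each of whose outcomes `a` stands for a
function `pred a`. -/
structure QuantumModel (n m N : ℕ) where
  dim₀ : ℕ
  init : DensityMatrix (Fin dim₀)
  work : ℕ → ℕ
  prep : Channel (Fin dim₀) (Bits n × Fin (work 0))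
  proc : ∀ t : ℕ, Channel (Bits m × Fin (work t)) (Bits n × Fin (work (t + 1)))
  outcomes : ℕ
  povm : Fin outcomes → Matrix (Bits n × Fin (work N)) (Bits n × Fin (work N)) ℂ
  povm_posSemidef : ∀ a, (povm a).PosSemidef
  povm_sum : ∑ a, povm a = 1
  pred : Fin outcomes → Bits n → ℝ

/-- The state after `t` queries: `C_t (E ⊗ I) C_{t-1} ⋯ C_1 (E ⊗ I) C_0 (ρ₀)`. -/
def QuantumModel.state {n m N : ℕ} (Q : QuantumModel n m N) (E : Channel (Bits n) (Bits m)) :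
    ∀ t : ℕ, Matrix (Bits n × Fin (Q.work t)) (Bits n × Fin (Q.work t)) ℂ
  | 0 => Q.prep.toLin Q.init.mat
  | t + 1 => (Q.proc t).toLin (tensorId E.toLin (Fin (Q.work t)) (Q.state E t))

open Classical in
/-- The probability that the function predicted by the quantum model lies in `s`. -/
def QuantumModel.prob {n m N : ℕ} (Q : QuantumModel n m N) (E : Channel (Bits n) (Bits m))
    (s : Set (Bits n → ℝ)) : ℝ :=
  ∑ a, if Q.pred a ∈ s then (Q.povm a * Q.state E N).trace.re else 0

/-! ### Restricted classical models -/

theorem sum_born {a : Type} [Fintype a] [DecidableEq a] (U : Matrix.unitaryGroup a ℂ)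
    (σ : DensityMatrix a) :
    ∑ i, ENNReal.ofReal (((U : Matrix a a ℂ)ᴴ * σ.mat * (U : Matrix a a ℂ)) i i).re = 1 := by
  have hp := σ.posSemidef.conjTranspose_mul_mul_same (U : Matrix a a ℂ)
  rw [← ENNReal.ofReal_sum_of_nonneg
    (fun i _ => (Complex.nonneg_iff.mp (hp.diag_nonneg (i := i))).1), ← Complex.re_sum]
  have h : ∑ i, ((U : Matrix a a ℂ)ᴴ * σ.mat * (U : Matrix a a ℂ)) i i = 1 := by
    change Matrix.trace _ = 1
    have hU : (U : Matrix a a ℂ) * (U : Matrix a a ℂ)ᴴ = 1 := Matrix.mem_unitaryGroup_iff.mp U.2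
    rw [Matrix.trace_mul_comm, ← Matrix.mul_assoc, hU, Matrix.one_mul, σ.trace_eq_one]
  rw [h]
  simp

/-- The law of the outcome of the projective measurement of the observable `O` on the state `σ`:
the outcome is the eigenvalue of the `i`-th vector `vᵢ` of an orthonormal eigenbasis of `O` with
probability `⟨vᵢ, σ vᵢ⟩`. -/
def measureObservable {a : Type} [Fintype a] [DecidableEq a] {O : Matrix a a ℂ}
    (hO : O.IsHermitian) (σ : DensityMatrix a) : PMF ℝ :=
  (PMF.ofFintype _ (sum_born hO.eigenvectorUnitary σ)).map hO.eigenvalues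

/-- A restricted classical model: a randomized adaptive choice of the next input, given the
data collected so far (most recent first), and a randomized choice of the
prediction function, given all data. -/
structure RestrictedModel (n : ℕ) where
  query : List (Bits n × ℝ) → PMF (Bits n)
  output : List (Bits n × ℝ) → PMF (Bits n → ℝ)

/-- The law of the data `(xᵢ, oᵢ)` of the first `N` experiments (most recent first), where `oᵢ` is
the outcome of measuring `O` on `E(|xᵢ⟩⟨xᵢ|)`. -/
def RestrictedModel.dataLaw {n m : ℕ} (M : RestrictedModel n) {O : Matrix (Bits m) (Bits m) ℂ}
    (hO : O.IsHermitian) (E : Channel (Bits n) (Bits m)) : ℕ → PMF (List (Bits n × ℝ))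
  | 0 => PMF.pure []
  | N + 1 => (M.dataLaw hO E N).bind fun data => (M.query data).bind fun x =>
      (measureObservable hO (E.apply (basisState x))).bind fun o => PMF.pure ((x, o) :: data)

/-- The probability that the function output after `N` experiments lies in `s`. -/
def RestrictedModel.prob {n m : ℕ} (M : RestrictedModel n) (N : ℕ)
    {O : Matrix (Bits m) (Bits m) ℂ} (hO : O.IsHermitian) (E : Channel (Bits n) (Bits m))
    (s : Set (Bits n → ℝ)) : ℝ :=
  (((M.dataLaw hO E N).bind M.output).toOuterMeasure s).toReal

/-! ### Packing nets and least squares -/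

/-- `S` is an `r`-packing net of the set of functions `T` for the average squared distance. -/
def IsPackingNet {n : ℕ} (D : PMF (Bits n)) (T : Set (Bits n → ℝ)) (r : ℝ)
    (S : Finset (Bits n → ℝ)) : Prop :=
  (S : Set (Bits n → ℝ)) ⊆ T ∧ ∀ f ∈ S, ∀ g ∈ S, f ≠ g → r < avgErr D f g

/-- A packing net of largest cardinality. -/
def IsMaximalPackingNet {n : ℕ} (D : PMF (Bits n)) (T : Set (Bits n → ℝ)) (r : ℝ)
    (S : Finset (Bits n → ℝ)) : Prop :=
  IsPackingNet D T r S ∧ ∀ S', IsPackingNet D T r S' → S'.card ≤ S.card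

/-- The empirical training error `(1/N) ∑ᵢ |f(xᵢ) - oᵢ|²`. -/
def trainingError {n : ℕ} (data : List (Bits n × ℝ)) (f : Bits n → ℝ) : ℝ :=
  (data.map fun p => |f p.1 - p.2| ^ 2).sum / data.length

/-- With `N` experiments, `M` draws all inputs independently from `D` and outputs a minimizer of the
empirical training error over `S` (ties broken in any way). -/
def RestrictedModel.IsLeastSquares {n : ℕ} (M : RestrictedModel n) (N : ℕ) (D : PMF (Bits n))
    (S : Finset (Bits n → ℝ)) : Prop :=
  (∀ data, data.length < N → M.query data = D) ∧
  ∀ data, data.length = N → ∀ f ∈ (M.output data).support,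
    f ∈ S ∧ ∀ g ∈ S, trainingError data f ≤ trainingError data g

end QML

end

namespace QML

/-! ### Replacement of a channel by the maximally mixed state -/

/-! Quantum side: no entropy is used. A channel into dimension d = 2^m is dominated, in the
completely positive order, by d² times the channel onto the maximally mixed state. Hence after N
queries the memory is at most 4^(mN) times one state that does not depend on the unknown channel
(`QuantumModel.state_le_replacement`), and success probabilities for disjoint goals sum to at most
4^(mN) (`QuantumModel.sum_prob_le`). The ε-balls around the points of a 4ε-packing net are disjoint,
so (2/3)|S| ≤ 4^(mN).

Classical side: some g in a maximal net is 4ε-close to the target. An f at distance at least 12ε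
beats g on the data with exponentially small probability, by an exponential moment of the difference
of squared losses. Outcomes are unbiased, so the linear term is a difference of average errors; the
quadratic term is controlled by d(f, g), which is itself of the order of these errors. This gives
the rate 1/ε instead of 1/ε² (`tsum_experiment_lossWeight_le`). A union bound over S yields part 2;
with the quantum bound on |S| it yields part 1(a). -/

open scoped MatrixOrder in
theorem _root_.Matrix.PosSemidef.re_trace_mul_nonneg {a : Type*} [Fintype a]
    {A B : Matrix a a ℂ} (hA : A.PosSemidef) (hB : B.PosSemidef) : 0 ≤ (A * B).trace.re := by
  classical
  obtain ⟨C, rfl⟩ := CStarAlgebra.nonneg_iff_eq_star_mul_self.mp hB.nonneg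
  have h := (hA.mul_mul_conjTranspose_same C).trace_nonneg
  rw [star_eq_conjTranspose, ← Matrix.mul_assoc, Matrix.trace_mul_comm, ← Matrix.mul_assoc]
  exact (Complex.nonneg_iff.mp h).1

/-- The partial trace over the first tensor factor. -/
noncomputable def traceFst {b k : Type} [Fintype b] (M : Matrix (b × k) (b × k) ℂ) : Matrix k k ℂ :=
  ∑ i, M.submatrix (Prod.mk i) (Prod.mk i)

theorem posSemidef_traceFst {b k : Type} [Fintype b] [Fintype k] {M : Matrix (b × k) (b × k) ℂ}
    (hM : M.PosSemidef) : (traceFst M).PosSemidef :=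
  Matrix.posSemidef_sum _ fun _ _ => hM.submatrix _

/-- A positive semidefinite matrix with two tensor factors is dominated by the dimension of the
first factor times the product of the identity and its partial trace. -/
theorem posSemidef_card_smul_one_kronecker_traceFst_sub {b k : Type} [Fintype b] [DecidableEq b]
    [Fintype k] {M : Matrix (b × k) (b × k) ℂ} (hM : M.PosSemidef) :
    ((Fintype.card b : ℂ) • Matrix.kronecker (1 : Matrix b b ℂ) (traceFst M) - M).PosSemidef := by
  classical
  -- `P i` projects onto block i. Half the sum of the sandwiches by `P i - P j` is d times the block
  -- diagonal of M, minus M: the pinching inequality.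
  let P : b → Matrix (b × k) (b × k) ℂ := fun i => diagonal fun p => if p.1 = i then 1 else 0
  have hP : ∀ i, (P i)ᴴ = P i := by
    intro i
    ext p q
    by_cases h : p = q
    · subst h; simp [P, Matrix.conjTranspose_apply, apply_ite]
    · simp [P, Matrix.conjTranspose_apply, h, Ne.symm h]
  have h1 : (∑ i, ∑ j, (P i - P j) * M * (P i - P j)ᴴ).PosSemidef :=
    Matrix.posSemidef_sum _ fun i _ => Matrix.posSemidef_sum _ fun j _ =>
      hM.mul_mul_conjTranspose_same _
  -- `T i j` moves block j to block i. The terms i ≠ j supply what the block diagonal of M lacks to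
  -- become 1 ⊗ (partial trace).
  let T : b → b → Matrix (b × k) (b × k) ℂ := fun i j =>
    of fun p q => if p.1 = i ∧ q = (j, p.2) then 1 else 0
  have h2 : (∑ i, ∑ j, if i = j then 0 else T i j * M * (T i j)ᴴ).PosSemidef := by
    refine Matrix.posSemidef_sum _ fun i _ => Matrix.posSemidef_sum _ fun j _ => ?_
    split_ifs
    · exact Matrix.PosSemidef.zero
    · exact hM.mul_mul_conjTranspose_same _
  have hT : ∀ i j p q, (T i j * M * (T i j)ᴴ) p q =
      if p.1 = i ∧ q.1 = i then M (j, p.2) (j, q.2) else 0 := by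
    intro i j p q
    have hL : ∀ s, (T i j * M) p s = if p.1 = i then M (j, p.2) s else 0 := by
      intro s
      by_cases h : p.1 = i <;> simp [Matrix.mul_apply, T, h]
    simp only [Matrix.mul_apply (M := T i j * M), hL, conjTranspose_apply]
    by_cases h : p.1 = i <;> by_cases h' : q.1 = i <;> simp [T, h, h', apply_ite]
  have e : (Fintype.card b : ℂ) • Matrix.kronecker (1 : Matrix b b ℂ) (traceFst M) - M =
      (1 / 2 : ℂ) • (∑ i, ∑ j, (P i - P j) * M * (P i - P j)ᴴ) +
      (Fintype.card b : ℂ) • (∑ i, ∑ j, if i = j then 0 else T i j * M * (T i j)ᴴ) := by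
    ext p q
    obtain ⟨i, x⟩ := p
    obtain ⟨j, y⟩ := q
    have hs : ∀ i' j' : b, ((P i' - P j') * M * (P i' - P j')ᴴ) (i, x) (j, y) =
        ((if i = i' then 1 else 0) - (if i = j' then 1 else 0)) * M (i, x) (j, y) *
        ((if j = i' then 1 else 0) - (if j = j' then 1 else 0)) := by
      intro i' j'
      rw [conjTranspose_sub, hP, hP]
      simp only [P, diagonal_sub, mul_diagonal, diagonal_mul]
    have hs2 : (∑ i', ∑ j', (P i' - P j') * M * (P i' - P j')ᴴ) (i, x) (j, y) =
        2 * ((if i = j then (Fintype.card b : ℂ) else 0) - 1) * M (i, x) (j, y) := by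
      simp only [Matrix.sum_apply, hs]
      simp only [sub_mul, mul_sub, Finset.sum_sub_distrib, ite_mul, mul_ite, zero_mul, mul_zero,
        one_mul, mul_one, Finset.sum_ite_eq, Finset.mem_univ, if_true, Finset.sum_const,
        Finset.card_univ, nsmul_eq_mul, Finset.sum_ite_irrel]
      by_cases h : i = j
      · subst h; simp; ring
      · simp [h]; ring
    have ht2 : (∑ i', ∑ j', if i' = j' then 0 else T i' j' * M * (T i' j')ᴴ) (i, x) (j, y) =
        if i = j then traceFst M x y - M (i, x) (i, y) else 0 := by
      have : ∀ i' j' : b, (if i' = j' then (0 : Matrix (b × k) (b × k) ℂ)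
          else T i' j' * M * (T i' j')ᴴ) (i, x) (j, y) =
          (if i = i' ∧ j = i' then M (j', x) (j', y) else 0) -
          (if i' = j' then (if i = i' ∧ j = i' then M (j', x) (j', y) else 0) else 0) := by
        intro i' j'
        by_cases h : i' = j'
        · simp [h]
        · simp [h, hT]
      simp only [Matrix.sum_apply, this, Finset.sum_sub_distrib]
      by_cases h : i = j
      · subst h
        simp [traceFst, Matrix.sum_apply]
      · rw [if_neg h]
        have h0 : ∀ i', ¬ (i = i' ∧ j = i') := fun i' hh => h (hh.1.trans hh.2.symm)
        simp [h0]
    rw [Matrix.add_apply, Matrix.smul_apply, Matrix.smul_apply, hs2, ht2, Matrix.sub_apply,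
      Matrix.smul_apply]
    by_cases h : i = j
    · subst h
      simp [Matrix.kronecker, kroneckerMap_apply]; ring
    · simp [Matrix.kronecker, kroneckerMap_apply, h]
  rw [e]
  refine (h1.smul ?_).add (h2.smul ?_)
  · rw [Complex.nonneg_iff]; norm_num
  · exact Nat.cast_nonneg _

theorem tensorId_eq_kronecker {a b k : Type} [Fintype a] [DecidableEq b]
    (E : Matrix a a ℂ →ₗ[ℂ] Matrix b b ℂ) (c : ℂ) (hE : ∀ M, E M = (c * M.trace) • 1)
    (M : Matrix (a × k) (a × k) ℂ) :
    tensorId E k M = c • Matrix.kronecker (1 : Matrix b b ℂ) (traceFst M) := by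
  ext ⟨i, x⟩ ⟨j, y⟩
  simp [tensorId, hE, traceFst, Matrix.kronecker, kroneckerMap_apply, Matrix.trace,
    Matrix.sum_apply, Matrix.one_apply]

/-- The channel that replaces every state by the maximally mixed state. -/
noncomputable def replacementChannel (a b : Type) [Fintype a] [Fintype b] [DecidableEq b]
    [Nonempty b] : Channel a b where
  toLin :=
    { toFun := fun M => ((Fintype.card b : ℂ)⁻¹ * M.trace) • 1
      map_add' := fun M N => by rw [trace_add, mul_add, add_smul]
      map_smul' := fun c M => by
        rw [trace_smul, RingHom.id_apply, smul_smul, smul_eq_mul, mul_left_comm] }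
  completelyPositive k M hM := by
    rw [tensorId_eq_kronecker _ _ (fun _ => rfl)]
    refine PosSemidef.smul (PosSemidef.kronecker PosSemidef.one (posSemidef_traceFst hM)) ?_
    rw [← Complex.ofReal_natCast, ← Complex.ofReal_inv]
    exact Complex.zero_le_real.mpr (by positivity)
  tracePreserving M := by
    simp [trace_smul, mul_right_comm _ M.trace]

/-- No-signalling: the ancilla's marginal does not see the channel. Hence the dominating operator is
the same for all channels. -/
theorem traceFst_tensorId {a b k : Type} [Fintype a] [Fintype b] (E : Channel a b)
    (M : Matrix (a × k) (a × k) ℂ) : traceFst (tensorId E.toLin k M) = traceFst M := by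
  ext x y
  have h := E.tracePreserving (Matrix.of fun i j => M (i, x) (j, y))
  simpa [traceFst, tensorId, Matrix.sum_apply, Matrix.trace] using h

theorem trace_tensorId {a b k : Type} [Fintype a] [Fintype b] [Fintype k] (E : Channel a b)
    (M : Matrix (a × k) (a × k) ℂ) : (tensorId E.toLin k M).trace = M.trace := by
  have h : ∀ {c : Type} [Fintype c] (N : Matrix (c × k) (c × k) ℂ),
      N.trace = (traceFst N).trace := by
    intro c _ N
    simp only [Matrix.trace, traceFst, Matrix.diag_apply, Matrix.sum_apply, submatrix_apply]
    rw [Fintype.sum_prod_type, Finset.sum_comm]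
  rw [h, traceFst_tensorId, ← h]

/-- Any channel is dominated, also in the presence of an ancilla, by the squared output dimension
times the replacement channel. -/
theorem posSemidef_replacementChannel_sub {a b : Type} [Fintype a] [Fintype b] [DecidableEq b]
    [Nonempty b] (E : Channel a b) {k : ℕ} {M : Matrix (a × Fin k) (a × Fin k) ℂ}
    (hM : M.PosSemidef) :
    ((Fintype.card b : ℂ) ^ 2 • tensorId (replacementChannel a b).toLin (Fin k) M -
      tensorId E.toLin (Fin k) M).PosSemidef := by
  have h := posSemidef_card_smul_one_kronecker_traceFst_sub (E.completelyPositive k M hM)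
  rw [traceFst_tensorId] at h
  -- One factor d comes from the partial trace bound, the other undoes the normalization 1/d of the
  -- maximally mixed state.
  rw [tensorId_eq_kronecker _ _ (fun _ => rfl), smul_smul, sq, mul_assoc,
    mul_inv_cancel₀ (Nat.cast_ne_zero.mpr Fintype.card_ne_zero), mul_one]
  exact h

/-! ### Domination of the quantum memory and the guessing bound -/

namespace QuantumModel

variable {n m N : ℕ} (Q : QuantumModel n m N)

theorem state_posSemidef (E : Channel (Bits n) (Bits m)) (t : ℕ) : (Q.state E t).PosSemidef := by
  induction t with
  | zero => exact Q.prep.map_posSemidef Q.init.posSemidef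
  | succ t ih => exact (Q.proc t).map_posSemidef (E.completelyPositive _ _ ih)

theorem trace_state (E : Channel (Bits n) (Bits m)) (t : ℕ) : (Q.state E t).trace = 1 := by
  induction t with
  | zero => rw [state, Channel.tracePreserving, Q.init.trace_eq_one]
  | succ t ih => rw [state, Channel.tracePreserving, trace_tensorId, ih]

theorem state_le_replacement (E : Channel (Bits n) (Bits m)) (t : ℕ) :
    ((((4 : ℝ) ^ (m * t) : ℝ) : ℂ) • Q.state (replacementChannel _ _) t -
      Q.state E t).PosSemidef := by
  induction t with
  | zero => simpa [state] using Matrix.PosSemidef.zero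
  | succ t ih =>
    -- Hybrid argument: `h1` exchanges the last query on the true state, `h2` the earlier ones by
    -- induction; the processing map preserves the order.
    have h1 := posSemidef_replacementChannel_sub E (Q.state_posSemidef E t)
    have h2 := ((replacementChannel (Bits n) (Bits m)).completelyPositive _ _ ih).smul
      (a := ((Fintype.card (Bits m) : ℂ) ^ 2)) (by positivity)
    have h := (Q.proc t).map_posSemidef (h2.add h1)
    convert h using 1
    simp only [state, map_add, map_sub, map_smul, smul_sub, smul_smul]
    have e : (((4 : ℝ) ^ (m * (t + 1)) : ℝ) : ℂ) =
        (Fintype.card (Bits m) : ℂ) ^ 2 * (((4 : ℝ) ^ (m * t) : ℝ) : ℂ) := by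
      have : (4 : ℂ) = 2 ^ 2 := by norm_num
      simp only [Fintype.card_fun, Fintype.card_bool, Fintype.card_fin]
      push_cast
      rw [mul_add, pow_add, mul_one, mul_comm, this, ← pow_mul, ← pow_mul, ← pow_mul, mul_comm 2 m]
    rw [e]
    abel

/-- The probabilities that a quantum model assigns to disjoint events when run on different
channels add up to at most `4 ^ (m * N)`. -/
theorem sum_prob_le {ι : Type*} (S : Finset ι) (E : ι → Channel (Bits n) (Bits m))
    (A : ι → Set (Bits n → ℝ)) (hA : ∀ i ∈ S, ∀ j ∈ S, i ≠ j → Disjoint (A i) (A j)) :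
    ∑ i ∈ S, Q.prob (E i) (A i) ≤ (4 : ℝ) ^ (m * N) := by
  classical
  set R := Q.state (replacementChannel _ _) N with hR
  have hp : ∀ a, 0 ≤ (Q.povm a * R).trace.re := fun a =>
    (Q.povm_posSemidef a).re_trace_mul_nonneg (Q.state_posSemidef _ N)
  have h1 : ∀ i a, (Q.povm a * Q.state (E i) N).trace.re ≤
      4 ^ (m * N) * (Q.povm a * R).trace.re := by
    intro i a
    have h := (Q.povm_posSemidef a).re_trace_mul_nonneg (Q.state_le_replacement (E i) N)
    rw [Matrix.mul_sub, Matrix.trace_sub, Matrix.mul_smul, Matrix.trace_smul, Complex.sub_re,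
      smul_eq_mul, Complex.re_ofReal_mul] at h
    linarith
  calc ∑ i ∈ S, Q.prob (E i) (A i)
      ≤ ∑ i ∈ S, ∑ a, if Q.pred a ∈ A i then 4 ^ (m * N) * (Q.povm a * R).trace.re else 0 := by
        refine Finset.sum_le_sum fun i _ => Finset.sum_le_sum fun a _ => ?_
        split_ifs
        · exact h1 i a
        · exact le_rfl
    _ = ∑ a, ∑ i ∈ S, if Q.pred a ∈ A i then 4 ^ (m * N) * (Q.povm a * R).trace.re else 0 :=
        Finset.sum_comm
    _ ≤ ∑ a, 4 ^ (m * N) * (Q.povm a * R).trace.re := by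
        refine Finset.sum_le_sum fun a _ => ?_
        -- An outcome carries one label, which lies in at most one of the disjoint sets.
        rw [← Finset.sum_filter, Finset.sum_const]
        have hc : (S.filter fun i => Q.pred a ∈ A i).card ≤ 1 := by
          refine Finset.card_le_one.mpr fun i hi j hj => ?_
          rw [Finset.mem_filter] at hi hj
          by_contra hij
          exact Set.disjoint_left.mp (hA i hi.1 j hj.1 hij) hi.2 hj.2
        rw [nsmul_eq_mul]
        exact mul_le_of_le_one_left (mul_nonneg (by positivity) (hp a)) (by exact_mod_cast hc)
    _ = 4 ^ (m * N) := by
        rw [← Finset.mul_sum, ← Complex.re_sum, ← Matrix.trace_sum, ← Matrix.sum_mul, Q.povm_sum,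
          Matrix.one_mul, hR, Q.trace_state]
        simp

end QuantumModel
/-! ### Sums over probability mass functions -/

theorem _root_.PMF.sum_toReal {α : Type*} [Fintype α] (D : PMF α) : ∑ x, (D x).toReal = 1 := by
  rw [← ENNReal.toReal_sum fun x _ => D.apply_ne_top x, ← tsum_fintype (L := .unconditional α),
    D.tsum_coe, ENNReal.toReal_one]

/-- Tower rule for expectations; values in `ℝ≥0∞` avoid summability conditions. -/
theorem _root_.PMF.tsum_bind_mul {α β : Type*} (p : PMF α) (q : α → PMF β) (φ : β → ℝ≥0∞) :
    ∑' b, p.bind q b * φ b = ∑' a, p a * ∑' b, q a b * φ b := by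
  simp only [PMF.bind_apply, ← ENNReal.tsum_mul_right, ← ENNReal.tsum_mul_left]
  rw [ENNReal.tsum_comm]
  simp only [mul_assoc]

theorem _root_.PMF.tsum_pure_mul {α : Type*} (a : α) (φ : α → ℝ≥0∞) :
    ∑' b, PMF.pure a b * φ b = φ a := by
  rw [tsum_eq_single a]
  · simp
  · intro b hb
    simp [hb]

theorem _root_.PMF.toOuterMeasure_le_one {α : Type*} (p : PMF α) (s : Set α) :
    p.toOuterMeasure s ≤ 1 := by
  rw [PMF.toOuterMeasure_apply, ← p.tsum_coe]
  exact ENNReal.tsum_le_tsum fun x => Set.indicator_le_self _ _ _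

theorem _root_.PMF.toOuterMeasure_ne_top {α : Type*} (p : PMF α) (s : Set α) :
    p.toOuterMeasure s ≠ ⊤ :=
  ne_top_of_le_ne_top ENNReal.one_ne_top (p.toOuterMeasure_le_one s)

/-! ### The average squared deviation -/

theorem avgErr_comm {n : ℕ} (D : PMF (Bits n)) (f g : Bits n → ℝ) :
    avgErr D f g = avgErr D g f := by
  simp only [avgErr, abs_sub_comm]

theorem avgErr_self {n : ℕ} (D : PMF (Bits n)) (f : Bits n → ℝ) : avgErr D f f = 0 := by
  simp [avgErr]

/-- Parallelogram identity: the defect at x is D(x)(f + g - 2h)². The factor 2 is why separation 4ε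
makes ε-balls disjoint. -/
theorem avgErr_le_two_mul_add {n : ℕ} (D : PMF (Bits n)) (f g h : Bits n → ℝ) :
    avgErr D f g ≤ 2 * avgErr D f h + 2 * avgErr D g h := by
  simp only [avgErr, Finset.mul_sum, ← Finset.sum_add_distrib, sq_abs]
  refine Finset.sum_le_sum fun x _ => ?_
  nlinarith [mul_nonneg (ENNReal.toReal_nonneg (a := D x)) (sq_nonneg (f x + g x - 2 * h x))]

theorem avgErr_le_four {n : ℕ} (D : PMF (Bits n)) {f g : Bits n → ℝ} (hf : ∀ x, |f x| ≤ 1)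
    (hg : ∀ x, |g x| ≤ 1) : avgErr D f g ≤ 4 := by
  calc avgErr D f g ≤ ∑ x, (D x).toReal * 4 := by
        refine Finset.sum_le_sum fun x _ => mul_le_mul_of_nonneg_left ?_ ENNReal.toReal_nonneg
        have h1 := abs_le.mp (hf x)
        have h2 := abs_le.mp (hg x)
        rw [sq_abs]
        nlinarith
    _ = 4 := by rw [← Finset.sum_mul, D.sum_toReal, one_mul]

/-- The target function is within the packing radius of some element of a maximal packing net. -/
theorem IsMaximalPackingNet.exists_avgErr_le {n : ℕ} {D : PMF (Bits n)} {T : Set (Bits n → ℝ)}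
    {r : ℝ} (hr : 0 ≤ r) {S : Finset (Bits n → ℝ)} (hS : IsMaximalPackingNet D T r S)
    {e : Bits n → ℝ} (he : e ∈ T) : ∃ g ∈ S, avgErr D g e ≤ r := by
  classical
  by_contra! h
  have heS : e ∉ S := fun hm => (h e hm).not_ge (by rwa [avgErr_self])
  have h2 := hS.2 (insert e S) ⟨by simpa [Set.insert_subset_iff, he] using hS.1.1, by
    intro f hf g hg hfg
    rw [Finset.mem_insert] at hf hg
    rcases hf with rfl | hf <;> rcases hg with rfl | hg
    · exact absurd rfl hfg
    · rw [avgErr_comm]; exact h g hg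
    · exact h f hf
    · exact hS.1.2 f hf g hg hfg⟩
  rw [Finset.card_insert_of_notMem heS] at h2
  omega

/-- If the cardinalities of packing nets are bounded, then there is a maximal packing net. -/
theorem exists_isMaximalPackingNet {n : ℕ} (D : PMF (Bits n)) (T : Set (Bits n → ℝ)) (r : ℝ)
    (K : ℕ) (hK : ∀ S, IsPackingNet D T r S → S.card ≤ K) : ∃ S, IsMaximalPackingNet D T r S := by
  have hfin : (Finset.card '' {S | IsPackingNet D T r S}).Finite :=
    (Set.finite_Iic K).subset (by rintro _ ⟨S, hS, rfl⟩; exact hK S hS)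
  have hne : {S | IsPackingNet D T r S}.Nonempty := ⟨∅, by simp [IsPackingNet]⟩
  obtain ⟨_, ⟨S, hS, rfl⟩, hmax⟩ := Set.exists_max_image _ id hfin (hne.image _)
  exact ⟨S, hS, fun S' hS' => hmax _ ⟨S', hS', rfl⟩⟩

/-! ### Measurement of an observable -/

theorem _root_.Matrix.IsHermitian.abs_eigenvalues_le_norm {a : Type*} [Fintype a] [DecidableEq a]
    {O : Matrix a a ℂ} (hO : O.IsHermitian) (i : a) :
    |hO.eigenvalues i| ≤ ‖Matrix.toEuclideanCLM (𝕜 := ℂ) O‖ := by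
  have h := (Matrix.toEuclideanCLM (𝕜 := ℂ) O).le_opNorm (hO.eigenvectorBasis i)
  have e : Matrix.toEuclideanCLM (𝕜 := ℂ) O (hO.eigenvectorBasis i) =
      hO.eigenvalues i • hO.eigenvectorBasis i := by
    ext j
    have := congrFun (hO.mulVec_eigenvectorBasis i) j
    simpa using this
  rwa [e, norm_smul, hO.eigenvectorBasis.orthonormal.1 i, mul_one, mul_one, Real.norm_eq_abs] at h

/-- The probability of the `i`-th outcome of the measurement of an observable. -/
noncomputable def born {a : Type} [Fintype a] [DecidableEq a] {O : Matrix a a ℂ}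
    (hO : O.IsHermitian) (σ : DensityMatrix a) (i : a) : ℝ :=
  (((hO.eigenvectorUnitary : Matrix a a ℂ)ᴴ * σ.mat * (hO.eigenvectorUnitary : Matrix a a ℂ)) i i).re

section
variable {a : Type} [Fintype a] [DecidableEq a] {O : Matrix a a ℂ} (hO : O.IsHermitian)
  (σ : DensityMatrix a)

theorem born_nonneg (i : a) : 0 ≤ born hO σ i :=
  (Complex.nonneg_iff.mp (σ.posSemidef.conjTranspose_mul_mul_same _).diag_nonneg).1

theorem sum_born_eq_one : ∑ i, born hO σ i = 1 := by
  have h := sum_born hO.eigenvectorUnitary σ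
  change ∑ i, ENNReal.ofReal (born hO σ i) = 1 at h
  rwa [← ENNReal.ofReal_sum_of_nonneg fun i _ => born_nonneg hO σ i, ENNReal.ofReal_eq_one] at h

/-- Spectral theorem and cyclicity of the trace: the outcome is an unbiased estimate of the target
value. -/
theorem sum_born_mul_eigenvalues :
    ∑ i, born hO σ i * hO.eigenvalues i = (O * σ.mat).trace.re := by
  set U : Matrix a a ℂ := (hO.eigenvectorUnitary : Matrix a a ℂ) with hU
  have hs : O = U * diagonal (RCLike.ofReal ∘ hO.eigenvalues) * Uᴴ := by
    conv_lhs => rw [hO.spectral_theorem, Unitary.conjStarAlgAut_apply]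
    rfl
  have : (O * σ.mat).trace =
      ((Uᴴ * σ.mat * U) * diagonal (RCLike.ofReal ∘ hO.eigenvalues)).trace := by
    conv_lhs => rw [hs]
    rw [Matrix.mul_assoc, Matrix.trace_mul_comm, ← Matrix.mul_assoc]
  rw [this, Matrix.trace, Complex.re_sum]
  refine Finset.sum_congr rfl fun i _ => ?_
  rw [diag_apply, mul_diagonal]
  simp [born, ← hU]

/-- Summing over eigenvectors rather than distinct eigenvalues makes degeneracy harmless. -/
theorem tsum_measureObservable (φ : ℝ → ℝ≥0∞) :
    ∑' o, measureObservable hO σ o * φ o =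
      ∑ i, ENNReal.ofReal (born hO σ i) * φ (hO.eigenvalues i) := by
  rw [measureObservable, ← PMF.bind_pure_comp]
  simp only [PMF.bind_apply, ← ENNReal.tsum_mul_right]
  rw [ENNReal.tsum_comm, tsum_fintype]
  refine Finset.sum_congr rfl fun i _ => ?_
  rw [tsum_eq_single (hO.eigenvalues i)]
  · simp [PMF.ofFintype_apply, born]
  · intro o ho
    simp [ho]

end

theorem abs_target_le_one {n m : ℕ} {O : Matrix (Bits m) (Bits m) ℂ} (hO : O.IsHermitian)
    (hn : ‖Matrix.toEuclideanCLM (𝕜 := ℂ) O‖ ≤ 1) (E : Channel (Bits n) (Bits m)) (x : Bits n) :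
    |target O E x| ≤ 1 := by
  rw [target, ← sum_born_mul_eigenvalues hO]
  calc _ ≤ ∑ i, |born hO (E.apply (basisState x)) i * hO.eigenvalues i| :=
        Finset.abs_sum_le_sum_abs _ _
    _ ≤ ∑ i, born hO (E.apply (basisState x)) i := by
        refine Finset.sum_le_sum fun i _ => ?_
        rw [abs_mul, abs_of_nonneg (born_nonneg _ _ _)]
        exact mul_le_of_le_one_right (born_nonneg _ _ _) ((hO.abs_eigenvalues_le_norm i).trans hn)
    _ = 1 := sum_born_eq_one _ _

/-! ### Concentration of the training error -/

/-- The weight of one experiment in the exponential moment of the difference of the squared losses. -/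
noncomputable def lossWeight {n : ℕ} (f g : Bits n → ℝ) (x : Bits n) (o : ℝ) : ℝ :=
  Real.exp (-((f x - o) ^ 2 - (g x - o) ^ 2) / 128)

/-- exp y ≤ 1 + y + y² for |y| ≤ 1, where |y| ≤ 8/128. Keeping the factor (f - g)² in the quadratic
term is what yields the fast rate. -/
theorem lossWeight_le {n : ℕ} {f g : Bits n → ℝ} {x : Bits n} {o : ℝ} (hf : |f x| ≤ 1)
    (hg : |g x| ≤ 1) (ho : |o| ≤ 1) :
    lossWeight f g x o ≤ 1 - (f x - g x) * (f x + g x - 2 * o) / 128 + (f x - g x) ^ 2 / 1024 := by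
  rw [abs_le] at hf hg ho
  set z := (f x - o) ^ 2 - (g x - o) ^ 2 with hz
  have e : z = (f x - g x) * (f x + g x - 2 * o) := by rw [hz]; ring
  have h1 : |f x - g x| ≤ 2 := abs_le.mpr ⟨by linarith, by linarith⟩
  have h2 : |f x + g x - 2 * o| ≤ 4 := abs_le.mpr ⟨by linarith, by linarith⟩
  have h3 : |z| ≤ 8 := by
    rw [e, abs_mul]
    calc _ ≤ (2 : ℝ) * 4 := mul_le_mul h1 h2 (abs_nonneg _) (by norm_num)
      _ = 8 := by norm_num
  have h4 : z ^ 2 ≤ 16 * (f x - g x) ^ 2 := by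
    rw [e, mul_pow, mul_comm]
    refine mul_le_mul_of_nonneg_right ?_ (sq_nonneg _)
    rw [← sq_abs]
    nlinarith [abs_nonneg (f x + g x - 2 * o)]
  have h5 := Real.abs_exp_sub_one_sub_id_le (x := -z / 128) (by
    rw [abs_div, abs_neg, abs_of_pos (by norm_num : (0 : ℝ) < 128)]
    linarith)
  have h6 := (abs_le.mp h5).2
  have h7 : (-z / 128) ^ 2 = z ^ 2 / 16384 := by ring
  have h8 : lossWeight f g x o = Real.exp (-z / 128) := rfl
  rw [h7, ← h8] at h6
  rw [← e]
  linarith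

/-- The weight of all data in the exponential moment of the difference of the sums of squared losses. -/
noncomputable def dataWeight {n : ℕ} (f g : Bits n → ℝ) (data : List (Bits n × ℝ)) : ℝ≥0∞ :=
  (data.map fun p => ENNReal.ofReal (lossWeight f g p.1 p.2)).prod

/-- Markov's inequality in pointwise form: the weight majorizes the indicator that f fits the data
at least as well as g. -/
theorem one_le_dataWeight {n : ℕ} {f g : Bits n → ℝ} {data : List (Bits n × ℝ)}
    (h : (data.map fun p => |f p.1 - p.2| ^ 2).sum ≤ (data.map fun p => |g p.1 - p.2| ^ 2).sum) :
    1 ≤ dataWeight f g data := by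
  have key : ∀ data : List (Bits n × ℝ), dataWeight f g data = ENNReal.ofReal (Real.exp
      (-((data.map fun p => |f p.1 - p.2| ^ 2).sum -
        (data.map fun p => |g p.1 - p.2| ^ 2).sum) / 128)) := by
    intro data
    induction data with
    | nil => simp [dataWeight]
    | cons p data ih =>
      rw [dataWeight, List.map_cons, List.prod_cons, ← dataWeight, ih, lossWeight,
        ← ENNReal.ofReal_mul (Real.exp_pos _).le, ← Real.exp_add]
      simp only [List.map_cons, List.sum_cons, sq_abs]
      congr 2
      ring
  rw [key, ENNReal.one_le_ofReal, Real.one_le_exp_iff]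
  linarith

section
variable {n m : ℕ} {O : Matrix (Bits m) (Bits m) ℂ} (hO : O.IsHermitian)
  (E : Channel (Bits n) (Bits m))

/-- The bound on the weight is affine in o, so o may be replaced by its mean; the variance of the
outcome never enters. -/
theorem sum_born_mul_lossWeight_le (hn : ‖Matrix.toEuclideanCLM (𝕜 := ℂ) O‖ ≤ 1)
    {f g : Bits n → ℝ} {x : Bits n} (hf : |f x| ≤ 1) (hg : |g x| ≤ 1) :
    ∑ i, born hO (E.apply (basisState x)) i * lossWeight f g x (hO.eigenvalues i) ≤
      1 - ((f x - target O E x) ^ 2 - (g x - target O E x) ^ 2) / 128 +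
        (f x - g x) ^ 2 / 1024 := by
  set p := born hO (E.apply (basisState x)) with hp
  have h1 : ∑ i, p i = 1 := sum_born_eq_one _ _
  have h2 : ∑ i, p i * hO.eigenvalues i = target O E x := sum_born_mul_eigenvalues _ _
  calc _ ≤ ∑ i, p i * (1 - (f x - g x) * (f x + g x - 2 * hO.eigenvalues i) / 128 +
          (f x - g x) ^ 2 / 1024) :=
        Finset.sum_le_sum fun i _ => mul_le_mul_of_nonneg_left
          (lossWeight_le hf hg ((hO.abs_eigenvalues_le_norm i).trans hn)) (born_nonneg _ _ _)
    _ = ∑ i, (p i * (1 - (f x - g x) * (f x + g x) / 128 + (f x - g x) ^ 2 / 1024) +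
          p i * hO.eigenvalues i * ((f x - g x) / 64)) :=
        Finset.sum_congr rfl fun i _ => by ring
    _ = _ := by
        rw [Finset.sum_add_distrib, ← Finset.sum_mul, ← Finset.sum_mul, h1, h2]
        ring

/-- One experiment with input drawn from `D` contracts the exponential moment if `f` is far from the
target and `g` is close to it. -/
theorem tsum_experiment_lossWeight_le (hn : ‖Matrix.toEuclideanCLM (𝕜 := ℂ) O‖ ≤ 1)
    (D : PMF (Bits n)) {f g : Bits n → ℝ} (hf : ∀ x, |f x| ≤ 1) (hg : ∀ x, |g x| ≤ 1) {ε : ℝ}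
    (hfE : 12 * ε ≤ avgErr D f (target O E)) (hgE : avgErr D g (target O E) ≤ 4 * ε) :
    ∑' x, D x * ∑' o, measureObservable hO (E.apply (basisState x)) o *
      ENNReal.ofReal (lossWeight f g x o) ≤ ENNReal.ofReal (Real.exp (-(ε / 32))) := by
  have hw : ∀ x i, 0 ≤ born hO (E.apply (basisState x)) i *
      lossWeight f g x (hO.eigenvalues i) :=
    fun x i => mul_nonneg (born_nonneg _ _ _) (Real.exp_pos _).le
  have e : ∑' x, D x * ∑' o, measureObservable hO (E.apply (basisState x)) o *
      ENNReal.ofReal (lossWeight f g x o) =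
      ENNReal.ofReal (∑ x, (D x).toReal * ∑ i, born hO (E.apply (basisState x)) i *
        lossWeight f g x (hO.eigenvalues i)) := by
    rw [tsum_fintype, ENNReal.ofReal_sum_of_nonneg fun x _ =>
      mul_nonneg ENNReal.toReal_nonneg (Finset.sum_nonneg fun i _ => hw x i)]
    refine Finset.sum_congr rfl fun x _ => ?_
    rw [ENNReal.ofReal_mul ENNReal.toReal_nonneg, ENNReal.ofReal_toReal (D.apply_ne_top x),
      tsum_measureObservable, ENNReal.ofReal_sum_of_nonneg fun i _ => hw x i]
    simp only [ENNReal.ofReal_mul (born_nonneg hO _ _)]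
  rw [e]
  refine ENNReal.ofReal_le_ofReal ?_
  have h1 : ∑ x, (D x).toReal * ∑ i, born hO (E.apply (basisState x)) i *
      lossWeight f g x (hO.eigenvalues i) ≤
      1 - (avgErr D f (target O E) - avgErr D g (target O E)) / 128 + avgErr D f g / 1024 := by
    calc _ ≤ ∑ x, (D x).toReal * (1 - ((f x - target O E x) ^ 2 - (g x - target O E x) ^ 2) / 128 +
            (f x - g x) ^ 2 / 1024) :=
          Finset.sum_le_sum fun x _ => mul_le_mul_of_nonneg_left
            (sum_born_mul_lossWeight_le hO E hn (hf x) (hg x)) ENNReal.toReal_nonneg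
      _ = ∑ x, ((D x).toReal - ((D x).toReal * (f x - target O E x) ^ 2 -
            (D x).toReal * (g x - target O E x) ^ 2) / 128 +
            (D x).toReal * (f x - g x) ^ 2 / 1024) :=
          Finset.sum_congr rfl fun x _ => by ring
      _ = _ := by
          simp only [Finset.sum_add_distrib, Finset.sum_sub_distrib, ← Finset.sum_div, D.sum_toReal,
            avgErr, sq_abs]
  -- With a ≥ 12ε and b ≤ 4ε the errors of f and g, the bound becomes 1 - (3a - 5b)/512 ≤ 1 - ε/32.
  have h2 := avgErr_le_two_mul_add D f g (target O E)
  have h3 := Real.add_one_le_exp (-(ε / 32))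
  linarith

namespace RestrictedModel

variable (M : RestrictedModel n)

theorem length_eq_of_mem_support_dataLaw {N : ℕ} {data : List (Bits n × ℝ)}
    (h : data ∈ (M.dataLaw hO E N).support) : data.length = N := by
  induction N generalizing data with
  | zero =>
    rw [dataLaw, PMF.support_pure, Set.mem_singleton_iff] at h
    rw [h, List.length_nil]
  | succ N ih =>
    simp only [dataLaw, PMF.mem_support_bind_iff, PMF.mem_support_pure_iff] at h
    obtain ⟨d, hd, x, -, o, -, rfl⟩ := h
    rw [List.length_cons, ih hd]

/-- The weight is a product and each input is fresh, so every experiment contributes a factor at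
most c, whatever the earlier data. -/
theorem tsum_dataLaw_mul_dataWeight_le (D : PMF (Bits n)) {f g : Bits n → ℝ} {c : ℝ≥0∞}
    (hc : ∑' x, D x * ∑' o, measureObservable hO (E.apply (basisState x)) o *
      ENNReal.ofReal (lossWeight f g x o) ≤ c) (N : ℕ)
    (hM : ∀ data, data.length < N → M.query data = D) :
    ∑' data, M.dataLaw hO E N data * dataWeight f g data ≤ c ^ N := by
  induction N with
  | zero => rw [dataLaw, PMF.tsum_pure_mul]; simp [dataWeight]
  | succ N ih =>
    rw [dataLaw]
    simp only [PMF.tsum_bind_mul, PMF.tsum_pure_mul]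
    calc _ ≤ ∑' data, M.dataLaw hO E N data * dataWeight f g data * c := by
          refine ENNReal.tsum_le_tsum fun data => ?_
          -- The query rule is known only for short data; data outside the support have probability
          -- 0.
          by_cases h : data ∈ (M.dataLaw hO E N).support
          · rw [hM data (by rw [length_eq_of_mem_support_dataLaw hO E M h]; omega), mul_assoc]
            gcongr
            calc _ = dataWeight f g data * ∑' x, D x * ∑' o,
                    measureObservable hO (E.apply (basisState x)) o *
                      ENNReal.ofReal (lossWeight f g x o) := by
                  simp only [dataWeight, List.map_cons, List.prod_cons, ← ENNReal.tsum_mul_left]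
                  refine tsum_congr fun x => tsum_congr fun o => ?_
                  ring
              _ ≤ _ := by gcongr
          · rw [PMF.mem_support_iff, not_not] at h
            simp [h]
      _ ≤ c ^ N * c := by
          rw [ENNReal.tsum_mul_right]
          gcongr
          exact ih fun data hd => hM data (hd.trans N.lt_succ_self)
      _ = c ^ (N + 1) := (pow_succ c N).symm

theorem one_sub_le_prob_of_compl_le {N : ℕ} {s : Set (Bits n → ℝ)} {δ : ℝ} (hδ : 0 ≤ δ)
    (h : ((M.dataLaw hO E N).bind M.output).toOuterMeasure sᶜ ≤ ENNReal.ofReal δ) :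
    1 - δ ≤ M.prob N hO E s := by
  set p := (M.dataLaw hO E N).bind M.output
  have h1 : p.toOuterMeasure s + p.toOuterMeasure sᶜ = 1 := by
    rw [PMF.toOuterMeasure_apply, PMF.toOuterMeasure_apply, ← ENNReal.tsum_add, ← p.tsum_coe]
    exact tsum_congr fun x => Set.indicator_self_add_compl_apply s p x
  have h4 := congrArg ENNReal.toReal h1
  rw [ENNReal.toReal_add (p.toOuterMeasure_ne_top _) (p.toOuterMeasure_ne_top _), ENNReal.toReal_one] at h4
  have h2 := ENNReal.toReal_le_of_le_ofReal hδ h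
  change 1 - δ ≤ (p.toOuterMeasure s).toReal
  linarith

/-- A least squares model errs with probability at most `|S| exp (-N ε / 32)`. -/
theorem IsLeastSquares.one_sub_le_prob (hn : ‖Matrix.toEuclideanCLM (𝕜 := ℂ) O‖ ≤ 1)
    {D : PMF (Bits n)} {S : Finset (Bits n → ℝ)} {M : RestrictedModel n} {N : ℕ}
    (hM : M.IsLeastSquares N D S) (hN : 0 < N) (hS : ∀ f ∈ S, ∀ x, |f x| ≤ 1) {ε δ : ℝ}
    {g : Bits n → ℝ} (hg : g ∈ S) (hgE : avgErr D g (target O E) ≤ 4 * ε)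
    (hδ : S.card * Real.exp (-(ε / 32)) ^ N ≤ δ) :
    1 - δ ≤ M.prob N hO E {h | avgErr D h (target O E) < 12 * ε} := by
  classical
  refine one_sub_le_prob_of_compl_le hO E M (le_trans (by positivity) hδ) ?_
  set s := {h | avgErr D h (target O E) < 12 * ε}
  set B := S.filter fun f => f ∉ s with hB
  rw [PMF.toOuterMeasure_bind_apply]
  calc _ ≤ ∑' data, M.dataLaw hO E N data * ∑ f ∈ B, dataWeight f g data := by
        refine ENNReal.tsum_le_tsum fun data => ?_
        by_cases hd : data ∈ (M.dataLaw hO E N).support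
        · gcongr
          have hl := length_eq_of_mem_support_dataLaw hO E M hd
          -- If the output can be bad, some bad f minimizes the training error, so it beats g and
          -- its weight alone is at least 1.
          by_cases h0 : (M.output data).toOuterMeasure sᶜ = 0
          · rw [h0]; exact bot_le
          · rw [PMF.toOuterMeasure_apply_eq_zero_iff, Set.not_disjoint_iff] at h0
            obtain ⟨f, hf, hfs⟩ := h0
            obtain ⟨hfS, hmin⟩ := hM.2 data hl f hf
            refine (PMF.toOuterMeasure_le_one _ _).trans ((one_le_dataWeight ?_).trans (Finset.single_le_sum
              (f := fun f => dataWeight f g data) (fun _ _ => bot_le)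
              (Finset.mem_filter.mpr ⟨hfS, hfs⟩)))
            have h2 := hmin g hg
            rw [trainingError, trainingError] at h2
            exact (div_le_div_iff_of_pos_right (by rw [hl]; exact_mod_cast hN)).mp h2
        · rw [PMF.mem_support_iff, not_not] at hd
          simp [hd]
    _ = ∑ f ∈ B, ∑' data, M.dataLaw hO E N data * dataWeight f g data := by
        simp only [Finset.mul_sum]
        exact Summable.tsum_finsetSum fun _ _ => ENNReal.summable
    _ ≤ ∑ f ∈ B, ENNReal.ofReal (Real.exp (-(ε / 32))) ^ N := by
        refine Finset.sum_le_sum fun f hf => ?_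
        rw [hB, Finset.mem_filter] at hf
        exact tsum_dataLaw_mul_dataWeight_le hO E M D (tsum_experiment_lossWeight_le hO E hn D
          (hS f hf.1) (hS g hg) (not_lt.mp hf.2) hgE) N hM.1
    _ = ENNReal.ofReal (B.card * Real.exp (-(ε / 32)) ^ N) := by
        rw [Finset.sum_const, nsmul_eq_mul, ENNReal.ofReal_mul (Nat.cast_nonneg _),
          ENNReal.ofReal_natCast, ENNReal.ofReal_pow (Real.exp_pos _).le]
    _ ≤ ENNReal.ofReal δ := by
        refine ENNReal.ofReal_le_ofReal (le_trans ?_ hδ)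
        gcongr
        exact Finset.filter_subset _ _

end RestrictedModel
end
-- Packing bound, sample size and construction of models
theorem QuantumModel.card_packingNet_le {n m N : ℕ} (Q : QuantumModel n m N) {D : PMF (Bits n)}
    {O : Matrix (Bits m) (Bits m) ℂ} {F : Set (Channel (Bits n) (Bits m))} {ε : ℝ}
    (hQ : ∀ E ∈ F, 2 / 3 ≤ Q.prob E {h | avgErr D h (target O E) ≤ ε})
    {S : Finset (Bits n → ℝ)} (hS : IsPackingNet D (target O '' F) (4 * ε) S) :
    (S.card : ℝ) ≤ 3 / 2 * 4 ^ (m * N) := by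
  choose E hEF hE using fun f : S => hS.1 f.2
  have h := Q.sum_prob_le S.attach E (fun f => {h | avgErr D h f ≤ ε}) (by
    intro f _ g _ hfg
    refine Set.disjoint_left.mpr fun h (hf : _ ≤ ε) (hg : _ ≤ ε) => ?_
    have h1 := hS.2 f f.2 g g.2 (Subtype.coe_ne_coe.mpr hfg)
    have h2 := avgErr_le_two_mul_add D (f : Bits n → ℝ) g h
    rw [avgErr_comm D f h, avgErr_comm D g h] at h2
    linarith)
  have h2 : S.attach.card • (2 / 3 : ℝ) ≤
      ∑ f ∈ S.attach, Q.prob (E f) {h | avgErr D h f ≤ ε} :=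
    Finset.card_nsmul_le_sum _ _ _ fun f _ => by
      have := hQ (E f) (hEF f)
      rwa [hE] at this
  rw [Finset.card_attach, nsmul_eq_mul] at h2
  linarith

/-- For K = 0 integrality of s absorbs the factor 3/2; for K ≥ 1 the slack in log 4 ≤ 3/2 does. -/
theorem log_card_le_of_le {s K : ℕ} (h : (s : ℝ) ≤ 3 / 2 * 4 ^ K) : Real.log s ≤ 2 * K := by
  rcases Nat.eq_zero_or_pos s with rfl | hs
  · simp
  rcases Nat.eq_zero_or_pos K with rfl | hK
  · have : s ≤ 1 := by
      by_contra! h2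
      have : (2 : ℝ) ≤ s := by exact_mod_cast h2
      norm_num at h
      linarith
    obtain rfl : s = 1 := by omega
    simp
  · have h1 := Real.log_le_log (by exact_mod_cast hs) h
    rw [Real.log_mul (by norm_num) (by positivity), Real.log_pow] at h1
    have h2 : Real.log (3 / 2) ≤ 1 / 2 :=
      (Real.log_le_sub_one_of_pos (by norm_num)).trans (by norm_num)
    have h3 : Real.log 4 ≤ 3 / 2 := by
      rw [show (4 : ℝ) = 2 ^ 2 by norm_num, Real.log_pow]
      have := Real.log_two_lt_d9
      push_cast
      linarith
    have hK' : (1 : ℝ) ≤ K := by exact_mod_cast hK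
    nlinarith

theorem IsMaximalPackingNet.one_sub_le_prob {n m : ℕ} {D : PMF (Bits n)}
    {O : Matrix (Bits m) (Bits m) ℂ} (hO : O.IsHermitian)
    (hn : ‖Matrix.toEuclideanCLM (𝕜 := ℂ) O‖ ≤ 1) {F : Set (Channel (Bits n) (Bits m))} {ε : ℝ}
    (hε : 0 < ε) {S : Finset (Bits n → ℝ)}
    (hS : IsMaximalPackingNet D (target O '' F) (4 * ε) S) {δ : ℝ} (hδ : 0 < δ) (hδ1 : δ < 1)
    {N : ℕ} (hN : 32 * Real.log (4 * S.card / δ) / ε ≤ N) {M : RestrictedModel n}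
    (hM : M.IsLeastSquares N D S) {E : Channel (Bits n) (Bits m)} (hE : E ∈ F) :
    1 - δ ≤ M.prob N hO E {h | avgErr D h (target O E) < 12 * ε} := by
  obtain ⟨g, hg, hgE⟩ := hS.exists_avgErr_le (by positivity) (Set.mem_image_of_mem _ hE)
  have hc : (1 : ℝ) ≤ S.card := by exact_mod_cast Finset.card_pos.mpr ⟨g, hg⟩
  have hlog : 0 < Real.log (4 * S.card / δ) :=
    Real.log_pos ((one_lt_div hδ).mpr (by linarith))
  have hN0 : (0 : ℝ) < N := lt_of_lt_of_le (by positivity) hN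
  refine hM.one_sub_le_prob hO E hn (by exact_mod_cast hN0) ?_ hg hgE ?_
  · intro f hf
    obtain ⟨E', -, rfl⟩ := hS.1.1 hf
    exact abs_target_le_one hO hn E'
  -- The sample size makes the union bound at most δ/4, more than needed.
  · rw [div_le_iff₀ hε] at hN
    rw [← Real.exp_nat_mul]
    calc _ ≤ S.card * Real.exp (-Real.log (4 * S.card / δ)) := by
          gcongr
          linarith
      _ = δ / 4 := by
          rw [Real.exp_neg, Real.exp_log (by positivity)]
          field_simp
      _ ≤ δ := by linarith

/-- The model that draws its inputs from `D` and outputs a function of the data. -/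
noncomputable def RestrictedModel.ofFun {n : ℕ} (D : PMF (Bits n))
    (out : List (Bits n × ℝ) → Bits n → ℝ) : RestrictedModel n where
  query _ := D
  output data := PMF.pure (out data)

theorem RestrictedModel.one_sub_le_prob_ofFun_const {n m : ℕ} (D : PMF (Bits n))
    {O : Matrix (Bits m) (Bits m) ℂ} (hO : O.IsHermitian) (E : Channel (Bits n) (Bits m)) (N : ℕ)
    {h : Bits n → ℝ} {s : Set (Bits n → ℝ)} (hs : h ∈ s) {δ : ℝ} (hδ : 0 ≤ δ) :
    1 - δ ≤ (ofFun D fun _ => h).prob N hO E s := by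
  refine one_sub_le_prob_of_compl_le hO E _ hδ ?_
  have : ((((ofFun D fun _ => h).dataLaw hO E N).bind (ofFun D fun _ => h).output).toOuterMeasure
      sᶜ) = 0 := by
    rw [PMF.toOuterMeasure_apply_eq_zero_iff]
    simpa [ofFun, Set.disjoint_compl_right_iff_subset] using hs
  rw [this]
  exact bot_le

theorem RestrictedModel.exists_isLeastSquares {n : ℕ} (D : PMF (Bits n))
    {S : Finset (Bits n → ℝ)} (hS : S.Nonempty) :
    ∃ M : RestrictedModel n, ∀ N, M.IsLeastSquares N D S := by
  choose f hf hmin using fun data : List (Bits n × ℝ) =>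
    Finset.exists_min_image S (trainingError data) hS
  refine ⟨ofFun D f, fun N => ⟨fun _ _ => rfl, fun data _ h hh => ?_⟩⟩
  rw [ofFun, PMF.mem_support_pure_iff] at hh
  subst hh
  exact ⟨hf data, hmin data⟩

/-- Since log(2/δ) ≥ 0.69 and K ≥ 1, the terms log 2, log s ≤ 2K and log(2/δ) are all multiples of K
log(2/δ); ε < 1/3 absorbs the rounding. -/
theorem sampleSize_le {s δ ε : ℝ} {K : ℕ} (hs : 1 ≤ s) (hlog : Real.log s ≤ 2 * K) (hK : 0 < K)
    (hδ : 0 < δ) (hδ1 : δ < 1) (hε : 0 < ε) (hε1 : ε < 1 / 3) :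
    (⌈32 * Real.log (4 * s / δ) / ε⌉₊ : ℝ) ≤ 200 * Real.log (2 / δ) * (K / ε) := by
  have hK' : (1 : ℝ) ≤ K := by exact_mod_cast hK
  have h2 := Real.log_two_gt_d9
  have hL : Real.log (2 / δ) = Real.log 2 - Real.log δ := Real.log_div (by norm_num) hδ.ne'
  have hδ' := Real.log_neg hδ hδ1
  have he : Real.log (4 * s / δ) = Real.log 2 + Real.log s + Real.log (2 / δ) := by
    rw [hL, Real.log_div (by positivity) hδ.ne', Real.log_mul (by norm_num) (by positivity),
      show (4 : ℝ) = 2 * 2 by norm_num, Real.log_mul (by norm_num) (by norm_num)]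
    ring
  have hnn : 0 ≤ Real.log (4 * s / δ) := Real.log_nonneg ((one_le_div hδ).mpr (by linarith))
  have h1 := (Nat.ceil_lt_add_one
    (a := 32 * Real.log (4 * s / δ) / ε) (by positivity)).le
  refine h1.trans ?_
  rw [← mul_div_assoc, div_add_one hε.ne', div_le_div_iff_of_pos_right hε, he]
  have hL2 : 0.69 ≤ Real.log (2 / δ) := by rw [hL]; linarith
  have h3 : 0.69 * K ≤ Real.log (2 / δ) * K := mul_le_mul_of_nonneg_right hL2 (by linarith)
  have h4 : Real.log (2 / δ) ≤ Real.log (2 / δ) * K := le_mul_of_one_le_right (by linarith) hK'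
  linarith

end QML

theorem theorem1 :
    ∃ C : ℝ, 0 < C ∧
      ∀ (n m : ℕ) (D : PMF (QML.Bits n))
        (O : Matrix (QML.Bits m) (QML.Bits m) ℂ) (hO : O.IsHermitian)
        (_ : ‖Matrix.toEuclideanCLM (𝕜 := ℂ) O‖ ≤ 1)
        (F : Set (QML.Channel (QML.Bits n) (QML.Bits m))) (ε : ℝ), 0 < ε →
        -- consequences of the existence of a quantum model with `NQ` queries
        (∀ (NQ : ℕ) (Q : QML.QuantumModel n m NQ),
          (∀ E ∈ F, 2 / 3 ≤ Q.prob E {h | QML.avgErr D h (QML.target O E) ≤ ε}) →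
          -- a restricted classical model exists
          (∀ δ : ℝ, 0 < δ → δ < 1 →
            ∃ (NC : ℕ) (M : QML.RestrictedModel n),
              (NC : ℝ) ≤ C * Real.log (2 / δ) * (m * NQ / ε) ∧
              ∀ E ∈ F, 1 - δ ≤ M.prob NC hO E
                {h | QML.avgErr D h (QML.target O E) ≤ 12 * ε}) ∧
          -- query lower bound
          (∀ S : Finset (QML.Bits n → ℝ), QML.IsPackingNet D (QML.target O '' F) (4 * ε) S →
            Real.log S.card ≤ C * (m * NQ))) ∧
        -- least squares over a maximal packing net
        (∀ S : Finset (QML.Bits n → ℝ), QML.IsMaximalPackingNet D (QML.target O '' F) (4 * ε) S →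
          ∀ δ : ℝ, 0 < δ → δ < 1 →
          ∀ N : ℕ, C * Real.log (4 * S.card / δ) / ε ≤ N →
          ∀ M : QML.RestrictedModel n, M.IsLeastSquares N D S →
          ∀ E ∈ F, 1 - δ ≤ M.prob N hO E
            {h | QML.avgErr D h (QML.target O E) < 12 * ε}) := by
  refine ⟨200, by norm_num, fun n m D O hO hn F ε hε => ⟨fun NQ Q hQ => ?_, ?_⟩⟩
  · have hcard : ∀ S : Finset (QML.Bits n → ℝ),
        QML.IsPackingNet D (QML.target O '' F) (4 * ε) S →
          (S.card : ℝ) ≤ 3 / 2 * 4 ^ (m * NQ) := fun S hS => Q.card_packingNet_le hQ hS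
    refine ⟨fun δ hδ hδ1 => ?_, fun S hS => ?_⟩
    -- For ε ≥ 1/3 the zero function already has error at most 4 ≤ 12ε.
    · rcases le_or_gt (1 / 3) ε with hε1 | hε1
      · refine ⟨0, QML.RestrictedModel.ofFun D fun _ _ => 0, ?_, fun E _ =>
          QML.RestrictedModel.one_sub_le_prob_ofFun_const D hO E 0 ?_ hδ.le⟩
        · have := Real.log_nonneg ((one_le_div hδ).mpr (by linarith : δ ≤ 2))
          rw [Nat.cast_zero]
          positivity
        · have := QML.avgErr_le_four D (f := fun _ => 0) (by simp)
            (QML.abs_target_le_one hO hn E)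
          rw [Set.mem_ofPred_eq]
          linarith
      rcases F.eq_empty_or_nonempty with rfl | ⟨E₀, hE₀⟩
      · refine ⟨0, QML.RestrictedModel.ofFun D fun _ _ => 0, ?_, fun E hE => hE.elim⟩
        have := Real.log_nonneg ((one_le_div hδ).mpr (by linarith : δ ≤ 2))
        rw [Nat.cast_zero]
        positivity
      obtain ⟨S, hS⟩ := QML.exists_isMaximalPackingNet D (QML.target O '' F) (4 * ε)
        ⌊(3 / 2 * 4 ^ (m * NQ) : ℝ)⌋₊ fun S hS => Nat.le_floor (hcard S hS)
      obtain ⟨g, hg, -⟩ := hS.exists_avgErr_le (by positivity) (Set.mem_image_of_mem _ hE₀)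
      -- If m * NQ = 0 no experiment is allowed, but then the net is the single point g, which is
      -- 4ε-close to every target.
      rcases Nat.eq_zero_or_pos (m * NQ) with hK | hK
      · have h1 : S.card ≤ 1 := by
          have h := hcard S hS.1
          rw [hK, pow_zero] at h
          have : (S.card : ℝ) < 2 := by linarith
          have : S.card < 2 := by exact_mod_cast this
          omega
        refine ⟨0, QML.RestrictedModel.ofFun D fun _ => g, ?_, fun E hE =>
          QML.RestrictedModel.one_sub_le_prob_ofFun_const D hO E 0 ?_ hδ.le⟩
        · rw [← Nat.cast_mul, hK]
          simp
        · obtain ⟨f, hf, hfE⟩ := hS.exists_avgErr_le (by positivity) (Set.mem_image_of_mem _ hE)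
          obtain rfl := Finset.card_le_one.mp h1 f hf g hg
          rw [Set.mem_ofPred_eq]
          linarith
      · obtain ⟨M, hM⟩ := QML.RestrictedModel.exists_isLeastSquares D ⟨g, hg⟩
        refine ⟨⌈32 * Real.log (4 * S.card / δ) / ε⌉₊, M, ?_, fun E hE => ?_⟩
        · rw [← Nat.cast_mul]
          exact QML.sampleSize_le (by exact_mod_cast Finset.card_pos.mpr ⟨g, hg⟩)
            (QML.log_card_le_of_le (hcard S hS.1)) hK hδ hδ1 hε hε1
        · refine (hS.one_sub_le_prob hO hn hε hδ hδ1 (Nat.le_ceil _) (hM _) hE).trans ?_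
          refine ENNReal.toReal_mono (PMF.toOuterMeasure_ne_top _ _)
            (MeasureTheory.measure_mono fun h hh => ?_)
          rw [Set.mem_ofPred_eq] at hh ⊢
          exact hh.le
    · have h := QML.log_card_le_of_le (hcard S hS)
      push_cast at h
      have : (0 : ℝ) ≤ m * NQ := by positivity
      linarith
  · intro S hS δ hδ hδ1 N hN M hM E hE
    obtain ⟨g, hg, -⟩ := hS.exists_avgErr_le (by positivity) (Set.mem_image_of_mem _ hE)
    have hc : (1 : ℝ) ≤ S.card := by exact_mod_cast Finset.card_pos.mpr ⟨g, hg⟩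
    have hlog : 0 ≤ Real.log (4 * S.card / δ) :=
      Real.log_nonneg ((one_le_div hδ).mpr (by linarith))
    -- Here 32 would suffice; the constant 200 is chosen for part 1(a).
    refine hS.one_sub_le_prob hO hn hε hδ hδ1 (le_trans ?_ hN) hM hE
    gcongr
    norm_num
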